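/- Let $(X,d)$ be a compact metric space and let $T\colon X\to X$ be a continuous map. Suppose that $(X,T)$ is transitive, i.e. for any two nonempty open sets $U,V\subset X$ there is $n>0$ with $T^n(U)\cap V\neq\emptyset$, and that $(X,T)$ has the shadowing property, i.e. for every $\varepsilon>0$ there is $\delta>0$ such that for every sequence $(x_n)_{n\ge 0}$ in $X$ with $d(T(x_n),x_{n+1})<\delta$ for all $n\ge 0$ there is $y\in X$ with $d(T^n(y),x_n)<\varepsilon$ for all $n\ge 0$. Let $M_T(X)$ denote the space of $T$-invariant Borel probability measures on $X$ with the weak$^*$ topology. Then the set of those $\mu\in M_T(X)$ that are ergodic and have full support, $\operatorname{supp}(\mu)=X$, is residual in $M_T(X)$, i.e. it contains a countable intersection of dense open subsets of $M_T(X)$. -/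

import Mathlib

open MeasureTheory

/-- `T` is (topologically) transitive: for any two nonempty open sets `U`, `V` there is `n > 0` such
that `T^n(U)` meets `V`. -/
def IsTransitiveMap {X : Type*} [TopologicalSpace X] (T : X → X) : Prop :=
  ∀ U V : Set X, IsOpen U → U.Nonempty → IsOpen V → V.Nonempty →
    ∃ n : ℕ, 0 < n ∧ ((T^[n] '' U) ∩ V).Nonempty

/-- The sequence `x` is a `δ`-pseudo-orbit of `T`. -/
def IsPseudoOrbit {X : Type*} [MetricSpace X] (T : X → X) (δ : ℝ) (x : ℕ → X) : Prop :=
  ∀ n : ℕ, dist (T (x n)) (x (n + 1)) < δ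

/-- The point `y` `ε`-traces the sequence `x` under `T`. -/
def Traces {X : Type*} [MetricSpace X] (T : X → X) (ε : ℝ) (y : X) (x : ℕ → X) : Prop :=
  ∀ n : ℕ, dist (T^[n] y) (x n) < ε

/-- The shadowing property: for every `ε > 0` there is `δ > 0` such that every `δ`-pseudo-orbit
is `ε`-traced by some point. -/
def HasShadowing {X : Type*} [MetricSpace X] (T : X → X) : Prop :=
  ∀ ε : ℝ, 0 < ε → ∃ δ : ℝ, 0 < δ ∧
    ∀ x : ℕ → X, IsPseudoOrbit T δ x → ∃ y : X, Traces T ε y x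

/-- The space `M_T(X)` of `T`-invariant Borel probability measures; as a type it carries the
subspace topology of the weak topology on `ProbabilityMeasure X`. -/
abbrev InvariantMeasures {X : Type*} [MeasurableSpace X] (T : X → X) : Type _ :=
  {μ : ProbabilityMeasure X // MeasurePreserving T (μ : Measure X) (μ : Measure X)}

/-!
The set in question is exhibited as a superset of a countable intersection of dense open sets,
with neither the ergodic decomposition nor the pointwise ergodic theorem. Write `A_n f` for the
`n`-th Birkhoff average of `f`.

*Ergodicity.* If for every `f` in a dense sequence of continuous functions the averages `A_n f`
with `n > 0` have variances arbitrarily close to zero with respect to an invariant measure `μ`,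
then `μ` is ergodic (`ergodic_of_birkhoffVariance`): the integral of `f` over an invariant set `s`
equals that of `A_n f` and is thus `μ(s) ∫ f dμ`, so that `μ` restricted to `s` is `μ(s) μ`, and evaluation at `s`
gives `μ(s) = μ(s)²`. For fixed `f` and `ε > 0`, the condition that some `A_n f` with `n > 0` has
variance less than `ε` is open in `μ`. Full support likewise amounts to the countably many open
conditions `0 < ∫ g dμ` for bump functions `g`.

*Density.* Given an invariant `μ`, finitely many continuous functions, combined into a
vector-valued `F`, and a continuous `g ≥ 0` with `g o > 0`, an invariant measure satisfying these
conditions is needed for which the mean of `F` is close to `c = ∫ F dμ`. By transitivity and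
compactness any two points are joined by `δ`-chains of bounded length, so every long orbit segment
extends at small relative cost to a closed chain at `o`. Closed chains at `o` can be concatenated,
hence the closure of the set of their `F`-averages is convex (`convex_closure_slopes`); as it is
close to all values of `A_n F` for large `n`, it contains `∫ A_n F dμ = c`
(`integral_mem_closure_slopes_loops`). Some closed chain at `o` thus has `F`-average close to `c`.
Let `L` be its length, and let `y` trace its periodic repetition. All values of `A_L F` along the
orbit of `y` are close to `c`, and every window of length `L` of this orbit comes close to `o`
(`exists_orbit_birkhoffAverage_near`). An invariant measure carried by the orbit closure of `y`
(`exists_invariantMeasure_of_orbit`) therefore gives `F` a mean close to `c`, gives `A_L F` small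
variance, and charges `{g > 0}` (`exists_invariantMeasure_near`).
-/

open Filter Topology Finset

/-! ### Birkhoff averages of continuous functions -/

section BirkhoffAverages

theorem Continuous.birkhoffAverage {X E : Type*} [TopologicalSpace X] [NormedAddCommGroup E]
    [NormedSpace ℝ E] {T : X → X} (hT : Continuous T) {F : X → E} (hF : Continuous F) (n : ℕ) :
    Continuous (birkhoffAverage ℝ T F n) :=
  (continuous_finsetSum _ fun k _ => hF.comp (hT.iterate k)).const_smul _

theorem norm_birkhoffAverage_le {X E : Type*} [NormedAddCommGroup E] [NormedSpace ℝ E]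
    {T : X → X} {F : X → E} {B : ℝ} (hB : ∀ x, ‖F x‖ ≤ B) {n : ℕ} (hn : 0 < n) (x : X) :
    ‖birkhoffAverage ℝ T F n x‖ ≤ B := by
  have hn' : (0 : ℝ) < n := by exact_mod_cast hn
  rw [birkhoffAverage, norm_smul, norm_inv, Real.norm_natCast, inv_mul_le_iff₀ hn']
  calc ‖birkhoffSum T F n x‖ ≤ ∑ _k ∈ range n, B := norm_sum_le_of_le _ fun k _ => hB _
    _ = n * B := by simp

theorem Continuous.integrable_of_compactSpace {X E : Type*} [TopologicalSpace X] [CompactSpace X]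
    [MeasurableSpace X] [OpensMeasurableSpace X] [NormedAddCommGroup E] {F : X → E}
    (hF : Continuous F) (μ : Measure X) [IsFiniteMeasure μ] : Integrable F μ :=
  hF.integrable_of_hasCompactSupport (HasCompactSupport.of_compactSpace F)

theorem MeasureTheory.MeasurePreserving.integral_birkhoffAverage {X E : Type*}
    [TopologicalSpace X] [CompactSpace X] [MeasurableSpace X] [BorelSpace X]
    [NormedAddCommGroup E] [NormedSpace ℝ E] {T : X → X} {μ : Measure X}
    [IsFiniteMeasure μ] (hμ : MeasurePreserving T μ μ) (hT : Continuous T) {F : X → E}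
    (hF : Continuous F) {n : ℕ} (hn : 0 < n) :
    ∫ x, birkhoffAverage ℝ T F n x ∂μ = ∫ x, F x ∂μ := by
  have key : ∀ k : ℕ, ∫ x, F (T^[k] x) ∂μ = ∫ x, F x ∂μ := fun k => by
    have h := hμ.iterate k
    conv_rhs => rw [← h.map_eq]
    rw [integral_map h.measurable.aemeasurable]
    exact (hF.integrable_of_compactSpace _).aestronglyMeasurable
  have hn' : (n : ℝ) ≠ 0 := by exact_mod_cast hn.ne'
  simp only [_root_.birkhoffAverage, _root_.birkhoffSum]
  have hint : ∀ k ∈ range n, Integrable (fun x => F (T^[k] x)) μ := fun k _ =>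
    (hF.comp (hT.iterate k)).integrable_of_compactSpace μ
  rw [integral_smul, integral_finsetSum _ hint, sum_congr rfl fun k _ => key k]
  simp [← Nat.cast_smul_eq_nsmul ℝ, smul_smul, hn']

end BirkhoffAverages

section InvariantMeasures

variable {X : Type*} [MetricSpace X] [CompactSpace X] [MeasurableSpace X] [BorelSpace X]
  {T : X → X}

/-! ### Invariant measures carried by an orbit closure -/

/-- The uniform distribution on the orbit segment `y, T y, …, T ^ n y`, of length `n + 1`. -/
noncomputable def empiricalMeasure (T : X → X) (y : X) (n : ℕ) : Measure X :=
  ((n + 1 : ℕ) : ENNReal)⁻¹ • ∑ k ∈ range (n + 1), Measure.dirac (T^[k] y)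

instance isProbabilityMeasure_empiricalMeasure (y : X) (n : ℕ) :
    IsProbabilityMeasure (empiricalMeasure T y n) where
  measure_univ := by
    simp only [empiricalMeasure, Measure.smul_apply, Measure.finsetSum_apply, measure_univ,
      sum_const, card_range, nsmul_eq_mul, mul_one, smul_eq_mul]
    exact ENNReal.inv_mul_cancel (by simp) (by simp)

theorem integral_empiricalMeasure (y : X) (n : ℕ) {h : X → ℝ} (hh : Continuous h) :
    ∫ x, h x ∂(empiricalMeasure T y n) = birkhoffAverage ℝ T h (n + 1) y := by
  rw [empiricalMeasure, integral_smul_measure,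
    integral_finsetSum_measure fun k _ => hh.integrable_of_compactSpace _]
  simp only [integral_dirac, birkhoffAverage, birkhoffSum, ENNReal.toReal_inv,
    ENNReal.toReal_natCast]

/-- The Krylov–Bogoliubov theorem, with control on the orbit: there is an invariant probability
measure all of whose mass lies on the orbit closure of `y`. The latter is expressed through
integrals: lower bounds along the orbit are inherited by the integral. -/
theorem exists_invariantMeasure_of_orbit (hT : Continuous T) (y : X) :
    ∃ ν : InvariantMeasures T, ∀ h : X → ℝ, Continuous h → ∀ a : ℝ,
      (∀ j : ℕ, a ≤ h (T^[j] y)) → a ≤ ∫ x, h x ∂(ν.1 : Measure X) := by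
  let p : ℕ → ProbabilityMeasure X := fun n => ⟨empiricalMeasure T y n, inferInstance⟩
  obtain ⟨ν, -, hν⟩ := isCompact_univ.ultrafilter_le_nhds
    (Ultrafilter.map p (Ultrafilter.of atTop)) (by simp)
  have hlim : Tendsto p (Ultrafilter.of atTop : Ultrafilter ℕ) (𝓝 ν) := hν
  have hle : ((Ultrafilter.of atTop : Ultrafilter ℕ) : Filter ℕ) ≤ atTop := Ultrafilter.of_le atTop
  have hint : ∀ h : X → ℝ, Continuous h →
      Tendsto (fun n => birkhoffAverage ℝ T h (n + 1) y) (Ultrafilter.of atTop : Ultrafilter ℕ)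
        (𝓝 (∫ x, h x ∂(ν : Measure X))) := fun h hh => by
    have := ProbabilityMeasure.tendsto_iff_forall_integral_tendsto.1 hlim
      (BoundedContinuousFunction.mkOfCompact ⟨h, hh⟩)
    refine this.congr fun n => ?_
    exact integral_empiricalMeasure y n hh
  have hinv : MeasurePreserving T (ν : Measure X) (ν : Measure X) := by
    refine ⟨hT.measurable, ?_⟩
    have : IsProbabilityMeasure (Measure.map T (ν : Measure X)) :=
      Measure.isProbabilityMeasure_map hT.measurable.aemeasurable
    refine ext_of_forall_integral_eq_of_IsFiniteMeasure fun f => ?_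
    rw [integral_map hT.measurable.aemeasurable
      (f.continuous.integrable_of_compactSpace _).aestronglyMeasurable]
    have h1 := (hint _ (f.continuous.comp hT)).sub (hint _ f.continuous)
    have h2 := ((tendsto_birkhoffAverage_apply_sub_birkhoffAverage' ℝ f.isBounded_range T y).comp
      (tendsto_add_atTop_nat 1)).mono_left hle
    refine sub_eq_zero.1 (tendsto_nhds_unique (h1.congr fun n => ?_) h2)
    simp only [birkhoffAverage, birkhoffSum, Function.comp_def, ← Function.iterate_succ_apply,
      Function.iterate_succ_apply']
  refine ⟨⟨ν, hinv⟩, fun h hh a ha => ge_of_tendsto' (hint h hh) fun n => ?_⟩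
  have hn : (0 : ℝ) < ((n + 1 : ℕ) : ℝ) := by positivity
  rw [birkhoffAverage, birkhoffSum, smul_eq_mul, le_inv_mul_iff₀ hn]
  calc ((n + 1 : ℕ) : ℝ) * a = ∑ _k ∈ range (n + 1), a := by simp
    _ ≤ _ := sum_le_sum fun k _ => ha k

/-! ### Ergodicity through variances of Birkhoff averages -/

theorem continuous_integral_continuousMap (μ : Measure X) [IsFiniteMeasure μ] :
    Continuous fun f : C(X, ℝ) => ∫ x, f x ∂μ := by
  refine LipschitzWith.continuous (K := (μ Set.univ).toNNReal)
    (LipschitzWith.of_dist_le_mul fun f g => ?_)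
  rw [dist_eq_norm, ← integral_sub (f.continuous.integrable_of_compactSpace _)
    (g.continuous.integrable_of_compactSpace _), mul_comm]
  exact norm_integral_le_of_norm_le_const (Eventually.of_forall fun x => by
    rw [← dist_eq_norm]; exact ContinuousMap.dist_apply_le_dist x)

/-- The variance of the Birkhoff average `A_n f` with respect to `μ`, written in a form whose
continuity in `μ` is visible; for an invariant `μ` and `n > 0` the mean of `A_n f` is `∫ f`. -/
noncomputable def birkhoffVariance (T : X → X) (f : X → ℝ) (n : ℕ) (μ : Measure X) : ℝ :=
  ∫ x, birkhoffAverage ℝ T f n x ^ 2 ∂μ - (∫ x, f x ∂μ) ^ 2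

theorem integral_sub_sq_eq_birkhoffVariance {μ : Measure X} [IsProbabilityMeasure μ]
    (hμ : MeasurePreserving T μ μ) (hT : Continuous T) {f : X → ℝ} (hf : Continuous f) {n : ℕ}
    (hn : 0 < n) (c : ℝ) :
    ∫ x, (birkhoffAverage ℝ T f n x - c) ^ 2 ∂μ =
      birkhoffVariance T f n μ + (∫ x, f x ∂μ - c) ^ 2 := by
  have hA := hT.birkhoffAverage hf n
  have e : ∀ x, (birkhoffAverage ℝ T f n x - c) ^ 2 =
      birkhoffAverage ℝ T f n x ^ 2 - 2 * c * birkhoffAverage ℝ T f n x + c ^ 2 := fun x => by ring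
  simp_rw [e]
  have h1 : Integrable (fun x => birkhoffAverage ℝ T f n x ^ 2) μ :=
    (hA.pow 2).integrable_of_compactSpace μ
  have h2 : Integrable (fun x => 2 * c * birkhoffAverage ℝ T f n x) μ :=
    (hA.const_mul _).integrable_of_compactSpace μ
  have h3 : Integrable
      (fun x => birkhoffAverage ℝ T f n x ^ 2 - 2 * c * birkhoffAverage ℝ T f n x) μ := h1.sub h2
  rw [integral_add h3 (integrable_const _), integral_sub h1 h2, integral_const_mul,
    hμ.integral_birkhoffAverage hT hf hn, birkhoffVariance]
  simp
  ring

/-- An invariant set `s` is independent of every `f` whose Birkhoff averages have arbitrarily small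
variance, because the integral of `f` over `s` is also that of its Birkhoff averages. -/
theorem setIntegral_eq_of_birkhoffVariance {μ : Measure X} [IsProbabilityMeasure μ]
    (hμ : MeasurePreserving T μ μ) (hT : Continuous T) {f : X → ℝ} (hf : Continuous f)
    (hvar : ∀ ε : ℝ, 0 < ε → ∃ n, 0 < n ∧ birkhoffVariance T f n μ < ε)
    {s : Set X} (hs : MeasurableSet s) (hinv : T ⁻¹' s = s) :
    ∫ x in s, f x ∂μ = μ.real s * ∫ x, f x ∂μ := by
  have hres : MeasurePreserving T (μ.restrict s) (μ.restrict s) := by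
    simpa only [hinv] using hμ.restrict_preimage hs
  set c := ∫ x, f x ∂μ with hc
  suffices H : ∀ η : ℝ, 0 < η → |∫ x in s, f x ∂μ - μ.real s * c| ≤ 2 * η by
    refine sub_eq_zero.1 (abs_nonpos_iff.1 (le_of_forall_pos_le_add fun η hη => ?_))
    linarith [H (η / 2) (by positivity)]
  intro η hη
  obtain ⟨n, hn, hlt⟩ := hvar (η ^ 2) (by positivity)
  have hA := hT.birkhoffAverage hf n
  have h2 : ∫ x, (birkhoffAverage ℝ T f n x - c) ^ 2 ∂μ < η ^ 2 := by
    rw [integral_sub_sq_eq_birkhoffVariance hμ hT hf hn]; simpa [← hc] using hlt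
  have hAc : Continuous fun x => birkhoffAverage ℝ T f n x - c := hA.sub continuous_const
  have e : ∫ x in s, f x ∂μ - μ.real s * c =
      ∫ x in s, (birkhoffAverage ℝ T f n x - c) ∂μ := by
    rw [integral_sub (hA.integrable_of_compactSpace _) (integrable_const _),
      hres.integral_birkhoffAverage hT hf hn]
    simp
  rw [e]
  calc |∫ x in s, (birkhoffAverage ℝ T f n x - c) ∂μ|
      ≤ ∫ x in s, |birkhoffAverage ℝ T f n x - c| ∂μ := abs_integral_le_integral_abs
    _ ≤ ∫ x, |birkhoffAverage ℝ T f n x - c| ∂μ :=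
        setIntegral_le_integral (hAc.abs.integrable_of_compactSpace _)
          (Eventually.of_forall fun x => abs_nonneg _)
    -- the pointwise bound `|t| ≤ t² / η + η` replaces the Cauchy–Schwarz inequality
    _ ≤ ∫ x, (η⁻¹ * (birkhoffAverage ℝ T f n x - c) ^ 2 + η) ∂μ := by
        refine integral_mono (hAc.abs.integrable_of_compactSpace _)
          ((((hAc.pow 2).const_mul _).add continuous_const).integrable_of_compactSpace _)
          fun x => ?_
        rw [← sq_abs]
        set t := |birkhoffAverage ℝ T f n x - c|
        have : t * η ≤ t ^ 2 + η * η := by nlinarith [sq_nonneg (t - η), sq_nonneg (t + η)]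
        have h3 : t ≤ (t ^ 2 + η * η) / η := (le_div_iff₀ hη).2 this
        calc t ≤ (t ^ 2 + η * η) / η := h3
          _ = η⁻¹ * t ^ 2 + η := by field_simp
    _ = η⁻¹ * ∫ x, (birkhoffAverage ℝ T f n x - c) ^ 2 ∂μ + η := by
        have h3 : Integrable (fun x => η⁻¹ * (birkhoffAverage ℝ T f n x - c) ^ 2) μ :=
          ((hAc.pow 2).const_mul _).integrable_of_compactSpace _
        rw [integral_add h3 (integrable_const _), integral_const_mul]
        simp
    _ ≤ η⁻¹ * η ^ 2 + η := by gcongr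
    _ = 2 * η := by field_simp; ring

/-- An invariant measure is ergodic if the Birkhoff averages of a dense set of continuous functions
have arbitrarily small variance: an invariant set `s` is then independent of all continuous
functions, hence of itself. -/
theorem ergodic_of_birkhoffVariance {ι : Type*} {u : ι → C(X, ℝ)} (hu : DenseRange u)
    {μ : Measure X} [IsProbabilityMeasure μ] (hμ : MeasurePreserving T μ μ) (hT : Continuous T)
    (hvar : ∀ i, ∀ ε : ℝ, 0 < ε → ∃ n, 0 < n ∧ birkhoffVariance T (u i) n μ < ε) :
    Ergodic T μ := by
  refine ⟨hμ, ⟨fun s hs hinv => ?_⟩⟩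
  have hall : ∀ f : C(X, ℝ), ∫ x in s, f x ∂μ = μ.real s * ∫ x, f x ∂μ := fun f =>
    hu.induction_on (p := fun f : C(X, ℝ) => ∫ x in s, f x ∂μ = μ.real s * ∫ x, f x ∂μ) f
      (isClosed_eq (continuous_integral_continuousMap _)
        ((continuous_integral_continuousMap _).const_mul _))
      fun i => setIntegral_eq_of_birkhoffVariance hμ hT (u i).continuous (hvar i) hs hinv
  have hmeas : μ.restrict s = (μ s).toNNReal • μ := by
    refine ext_of_forall_integral_eq_of_IsFiniteMeasure fun f => ?_
    rw [integral_smul_nnreal_measure]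
    exact hall f.toContinuousMap
  have hsq : μ s = μ s * μ s := by
    have := congrArg (fun m : Measure X => m s) hmeas
    simpa [Measure.restrict_apply hs, ENNReal.smul_def] using this
  rw [eventuallyConst_set']
  by_cases h0 : μ s = 0
  · exact Or.inl (ae_eq_empty.2 h0)
  · refine Or.inr ((ae_eq_univ_iff_measure_eq hs.nullMeasurableSet).2 ?_)
    rw [measure_univ]
    exact (ENNReal.mul_eq_left h0 (measure_ne_top _ _)).1 hsq.symm

/-! ### The weak topology on the invariant measures -/

theorem continuous_integral_invariantMeasures {h : X → ℝ} (hh : Continuous h) :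
    Continuous fun ν : InvariantMeasures T => ∫ x, h x ∂(ν.1 : Measure X) :=
  (ProbabilityMeasure.continuous_integral_boundedContinuousFunction
    (BoundedContinuousFunction.mkOfCompact ⟨h, hh⟩)).comp continuous_subtype_val

theorem continuous_birkhoffVariance (hT : Continuous T) {f : X → ℝ} (hf : Continuous f) (n : ℕ) :
    Continuous fun ν : InvariantMeasures T => birkhoffVariance T f n (ν.1 : Measure X) :=
  (continuous_integral_invariantMeasures ((hT.birkhoffAverage hf n).pow 2)).sub
    ((continuous_integral_invariantMeasures hf).pow 2)

end InvariantMeasures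

/-- Density in the weak topology can be tested on finitely many continuous functions at a time. -/
theorem dense_of_forall_finset_integral {X : Type*} [TopologicalSpace X]
    [MeasurableSpace X] [OpensMeasurableSpace X] {T : X → X} {P : Set (InvariantMeasures T)}
    (hP : ∀ μ : InvariantMeasures T, ∀ S : Finset C(X, ℝ), ∀ ε : ℝ, 0 < ε →
      ∃ ν ∈ P, ∀ f ∈ S, |∫ x, f x ∂(ν.1 : Measure X) - ∫ x, f x ∂(μ.1 : Measure X)| ≤ ε) :
    Dense P := by
  classical
  intro μ
  choose ν hνP hν using fun q : Finset C(X, ℝ) × ℕ =>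
    hP μ q.1 (1 / ((q.2 : ℝ) + 1)) (by positivity)
  refine mem_closure_of_tendsto (b := atTop) (f := ν) ?_ (Eventually.of_forall hνP)
  rw [tendsto_subtype_rng, ProbabilityMeasure.tendsto_iff_forall_integral_tendsto]
  intro f
  rw [tendsto_iff_dist_tendsto_zero]
  have h0 : Tendsto (fun q : Finset C(X, ℝ) × ℕ => 1 / ((q.2 : ℝ) + 1)) atTop (𝓝 0) := by
    rw [← prod_atTop_atTop_eq]
    exact (tendsto_one_div_add_atTop_nhds_zero_nat (𝕜 := ℝ)).comp tendsto_snd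
  refine squeeze_zero' (Eventually.of_forall fun q => dist_nonneg) ?_ h0
  filter_upwards [eventually_ge_atTop (({f.toContinuousMap}, 0) : Finset C(X, ℝ) × ℕ)] with q hq
  exact hν q f.toContinuousMap (hq.1 (mem_singleton_self _))

/-! ### Chains -/

/-- There is a finite `δ`-chain of `T` from `a` to `b` with `L` steps along which the values of `F`,
the end point `b` excluded, add up to `s`. -/
def HasChain {X E : Type*} [MetricSpace X] [AddCommMonoid E] (T : X → X) (δ : ℝ) (F : X → E)
    (a b : X) (L : ℕ) (s : E) : Prop :=
  ∃ z : ℕ → X, z 0 = a ∧ z L = b ∧ (∀ n < L, dist (T (z n)) (z (n + 1)) < δ) ∧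
    ∑ n ∈ range L, F (z n) = s

namespace HasChain

section AddCommMonoid

variable {X E : Type*} [MetricSpace X] [AddCommMonoid E] {T : X → X} {δ : ℝ} {F : X → E}
  {a b c : X} {L L' : ℕ} {s s' : E}

theorem refl (T : X → X) (δ : ℝ) (F : X → E) (a : X) : HasChain T δ F a a 0 0 :=
  ⟨fun _ => a, by simp⟩

theorem trans (h : HasChain T δ F a b L s) (h' : HasChain T δ F b c L' s') :
    HasChain T δ F a c (L + L') (s + s') := by
  obtain ⟨z, z0, zL, hz, rfl⟩ := h
  obtain ⟨w, w0, wL, hw, rfl⟩ := h'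
  have e1 : ∀ n ≤ L, (if n < L then z n else w (n - L)) = z n := fun n hn => by
    rcases hn.lt_or_eq with h | rfl
    · rw [if_pos h]
    · simp [w0, zL]
  have e2 : ∀ n, (if L + n < L then z (L + n) else w (L + n - L)) = w n := fun n => by simp
  refine ⟨fun n => if n < L then z n else w (n - L), ?_, ?_, fun n hn => ?_, ?_⟩
  · simpa only [z0] using e1 0 L.zero_le
  · simpa only [wL] using e2 L'
  · rcases lt_or_ge n L with h | h
    · simpa only [e1 n h.le, e1 (n + 1) h] using hz n h
    · obtain ⟨k, rfl⟩ := Nat.exists_eq_add_of_le h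
      have e3 := e2 (k + 1)
      rw [← add_assoc] at e3
      simpa only [e2 k, e3] using hw k (by omega)
  · rw [sum_range_add]
    congr 1
    · exact sum_congr rfl fun n hn => by simp only [e1 n (mem_range.1 hn).le]
    · exact sum_congr rfl fun n _ => by simp only [e2 n]

theorem single (h : dist (T a) b < δ) : HasChain T δ F a b 1 (F a) :=
  ⟨fun n => if n = 0 then a else b, by simpa using h⟩

theorem orbit (hδ : 0 < δ) (a : X) (n : ℕ) :
    HasChain T δ F a (T^[n] a) n (birkhoffSum T F n a) :=
  ⟨fun k => T^[k] a, rfl, rfl, fun k _ => by simpa [Function.iterate_succ_apply'] using hδ, rfl⟩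

/-- A closed chain, run through periodically, is a pseudo-orbit. -/
theorem exists_periodic (h : HasChain T δ F a a L s) (hL : 0 < L) :
    ∃ z : ℕ → X, IsPseudoOrbit T δ z ∧ z.Periodic L ∧ z 0 = a ∧ ∑ n ∈ range L, F (z n) = s := by
  obtain ⟨z, z0, zL, hz, rfl⟩ := h
  refine ⟨fun n => z (n % L), fun n => ?_, fun n => by simp, by simpa using z0,
    sum_congr rfl fun n hn => by simp only [Nat.mod_eq_of_lt (mem_range.1 hn)]⟩
  have hlt := Nat.mod_lt n hL
  have key : z ((n + 1) % L) = z (n % L + 1) := by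
    rw [← Nat.mod_add_mod]
    rcases (Nat.succ_le_of_lt hlt).lt_or_eq with h | h
    · rw [Nat.mod_eq_of_lt h]
    · simp only [Nat.succ_eq_add_one] at h
      rw [h, Nat.mod_self, z0, zL]
  simpa only [key] using hz _ hlt

variable (T δ F a) in
/-- The closed chains at `a`, recorded by their length and their `F`-sum. -/
def loops : AddSubmonoid (ℕ × E) where
  carrier := {p | HasChain T δ F a a p.1 p.2}
  zero_mem' := refl T δ F a
  add_mem' h h' := trans h h'

end AddCommMonoid

theorem norm_le {X E : Type*} [MetricSpace X] [SeminormedAddCommGroup E] {T : X → X} {δ : ℝ}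
    {F : X → E} {a b : X} {L : ℕ} {s : E} (h : HasChain T δ F a b L s) {B : ℝ}
    (hB : ∀ x, ‖F x‖ ≤ B) : ‖s‖ ≤ L * B := by
  obtain ⟨z, -, -, -, rfl⟩ := h
  calc ‖∑ n ∈ range L, F (z n)‖ ≤ ∑ _n ∈ range L, B := norm_sum_le_of_le _ fun n _ => hB _
    _ = L * B := by simp

/-- Transitivity and compactness yield `δ`-chains of uniformly bounded length between any two
points: finitely many pairs of balls have to be connected. -/
theorem exists_bounded_length {X E : Type*} [MetricSpace X] [CompactSpace X] [AddCommMonoid E]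
    {T : X → X} (htrans : IsTransitiveMap T) {δ : ℝ} (hδ : 0 < δ) (F : X → E) :
    ∃ M : ℕ, ∀ a b : X, ∃ L ≤ M, ∃ s, HasChain T δ F a b L s := by
  have hne : ∀ p : X, (Metric.ball p (δ / 2)).Nonempty := fun p =>
    ⟨p, Metric.mem_ball_self (by positivity)⟩
  choose N hN0 hN using fun p q : X => htrans (Metric.ball p (δ / 2)) (Metric.ball q (δ / 2))
    Metric.isOpen_ball (hne p) Metric.isOpen_ball (hne q)
  obtain ⟨t, -, htfin, ht⟩ :=
    finite_cover_balls_of_compact (isCompact_univ (X := X)) (half_pos hδ)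
  obtain ⟨M, hM⟩ := ((htfin.prod htfin).image fun r => N r.1 r.2).bddAbove
  refine ⟨M + 1, fun a b => ?_⟩
  obtain ⟨p, hp, hap⟩ := Set.mem_iUnion₂.1 (ht (Set.mem_univ (T a)))
  obtain ⟨q, hq, hbq⟩ := Set.mem_iUnion₂.1 (ht (Set.mem_univ b))
  obtain ⟨_, ⟨u, hu, rfl⟩, hv⟩ := hN p q
  have hle : N p q ≤ M := hM ⟨(p, q), ⟨hp, hq⟩, rfl⟩
  obtain ⟨n, hn⟩ := Nat.exists_eq_succ_of_ne_zero (hN0 p q).ne'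
  rw [hn, Nat.succ_eq_add_one, Function.iterate_succ_apply'] at hv
  have h1 : dist (T a) u < δ := by
    linarith [dist_triangle_right (T a) u p, Metric.mem_ball.1 hap, Metric.mem_ball.1 hu]
  have h2 : dist (T (T^[n] u)) b < δ := by
    linarith [dist_triangle_right (T (T^[n] u)) b q, Metric.mem_ball.1 hbq, Metric.mem_ball.1 hv]
  exact ⟨1 + n + 1, by omega, _, ((single h1).trans (orbit hδ u n)).trans (single h2)⟩

end HasChain

/-! ### Averages over closed chains -/

/-- The averages `s / L` of the elements `(L, s)` with `L > 0` of a set `Λ`. -/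
def slopes {E : Type*} [AddCommGroup E] [Module ℝ E] (Λ : Set (ℕ × E)) : Set E :=
  {v | ∃ p ∈ Λ, 0 < p.1 ∧ (p.1 : ℝ)⁻¹ • p.2 = v}

/-- The slopes of an additive submonoid are closed under rational convex combinations, so that
their closure is convex. -/
theorem convex_closure_slopes {E : Type*} [NormedAddCommGroup E] [NormedSpace ℝ E]
    (Λ : AddSubmonoid (ℕ × E)) : Convex ℝ (closure (slopes (Λ : Set (ℕ × E)))) := by
  intro x hx y hy a b ha hb hab
  rw [← closure_closure]
  refine map_mem_closure₂ (f := fun x y => a • x + b • y) (by fun_prop) hx hy ?_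
  rintro _ ⟨⟨L, s⟩, hs, hL, rfl⟩ _ ⟨⟨L', s'⟩, hs', hL', rfl⟩
  dsimp only at hL hL' ⊢
  have h1 : Tendsto (fun k : ℕ => (⌊a * (k : ℝ)⌋₊ : ℝ) / k) atTop (𝓝 a) :=
    (tendsto_nat_floor_mul_div_atTop ha).comp tendsto_natCast_atTop_atTop
  have h2 : Tendsto (fun k : ℕ => 1 - (⌊a * (k : ℝ)⌋₊ : ℝ) / k) atTop (𝓝 b) := by
    rw [show b = 1 - a by linarith]
    exact tendsto_const_nhds.sub h1
  refine mem_closure_of_tendsto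
    ((h1.smul_const ((L : ℝ)⁻¹ • s)).add (h2.smul_const ((L' : ℝ)⁻¹ • s'))) ?_
  filter_upwards [eventually_gt_atTop 0] with k hk
  have hpk : ⌊a * (k : ℝ)⌋₊ ≤ k := Nat.floor_le_of_le (by
    calc a * (k : ℝ) ≤ 1 * k := by gcongr; linarith
      _ = k := one_mul _)
  obtain ⟨q, hq⟩ := Nat.exists_eq_add_of_le hpk
  set p := ⌊a * (k : ℝ)⌋₊
  -- multiplicities that give the two blocks the total lengths `p * (L * L')` and `q * (L * L')`
  refine ⟨(p * L') • (L, s) + (q * L) • (L', s'),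
    Λ.add_mem (Λ.nsmul_mem hs _) (Λ.nsmul_mem hs' _), ?_, ?_⟩
  · have : 0 < k * (L * L') := by positivity
    simp only [Prod.smul_mk, Prod.mk_add_mk, smul_eq_mul]
    rw [hq] at this
    linarith
  · have hkr : (k : ℝ) = p + q := by exact_mod_cast hq
    have hpq : (0 : ℝ) < p + q := by rw [← hkr]; exact_mod_cast hk
    have hLr : (0 : ℝ) < L := by exact_mod_cast hL
    have hLr' : (0 : ℝ) < L' := by exact_mod_cast hL'
    simp only [Prod.smul_mk, Prod.mk_add_mk, smul_eq_mul, ← Nat.cast_smul_eq_nsmul ℝ, smul_add,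
      smul_smul, hkr]
    push_cast
    have e : (p : ℝ) * L' * L + q * L * L' = (p + q) * (L * L') := by ring
    rw [e]
    congr 2
    · field_simp
    · field_simp
      ring

section Approximation

variable {X E : Type*} [MetricSpace X] [CompactSpace X] [NormedAddCommGroup E] [NormedSpace ℝ E]
  {T : X → X}

/-- A long orbit segment can be completed to a closed chain at `o` at bounded cost, so that its
average is close to the average over a closed chain. -/
theorem exists_slope_near_birkhoffAverage (htrans : IsTransitiveMap T) {δ : ℝ} (hδ : 0 < δ)
    {F : X → E} (hF : Continuous F) (o : X) {ε : ℝ} (hε : 0 < ε) :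
    ∃ n, 0 < n ∧ ∀ x, ∃ v ∈ slopes (HasChain.loops T δ F o : Set (ℕ × E)),
      dist (birkhoffAverage ℝ T F n x) v ≤ ε := by
  obtain ⟨M, hM⟩ := HasChain.exists_bounded_length htrans hδ F
  obtain ⟨B, hB⟩ := isCompact_univ.exists_bound_of_continuousOn hF.continuousOn
  replace hB : ∀ x, ‖F x‖ ≤ B := fun x => hB x (Set.mem_univ x)
  have hB0 : 0 ≤ B := (norm_nonneg _).trans (hB o)
  obtain ⟨n, hn⟩ := exists_nat_gt (4 * M * B / ε)
  have hn0 : 0 < n := by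
    have : (0 : ℝ) < n := lt_of_le_of_lt (by positivity) hn
    exact_mod_cast this
  have hnr : (0 : ℝ) < n := by exact_mod_cast hn0
  refine ⟨n, hn0, fun x => ?_⟩
  obtain ⟨L₁, hL₁, s₁, h₁⟩ := hM o x
  obtain ⟨L₂, hL₂, s₂, h₂⟩ := hM (T^[n] x) o
  have h := (h₁.trans (HasChain.orbit hδ x n)).trans h₂
  refine ⟨_, ⟨(L₁ + n + L₂, s₁ + birkhoffSum T F n x + s₂), h, by dsimp only; omega, rfl⟩, ?_⟩
  dsimp only
  set A := birkhoffAverage ℝ T F n x with hA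
  have hS : birkhoffSum T F n x = (n : ℝ) • A := by
    rw [hA, birkhoffAverage, smul_smul, mul_inv_cancel₀ hnr.ne', one_smul]
  set L : ℝ := ((L₁ + n + L₂ : ℕ) : ℝ) with hLdef
  have hLeq : L = L₁ + n + L₂ := by rw [hLdef]; push_cast; ring
  have hL1 : (L₁ : ℝ) ≤ M := by exact_mod_cast hL₁
  have hL2 : (L₂ : ℝ) ≤ M := by exact_mod_cast hL₂
  have hnL : (n : ℝ) ≤ L := by
    rw [hLeq]
    linarith [L₁.cast_nonneg (α := ℝ), L₂.cast_nonneg (α := ℝ)]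
  have hL0 : 0 < L := hnr.trans_le hnL
  have e : A - L⁻¹ • (s₁ + birkhoffSum T F n x + s₂) =
      L⁻¹ • (((L₁ : ℝ) • A + (L₂ : ℝ) • A) - (s₁ + s₂)) := by
    have : A = L⁻¹ • (L • A) := by rw [smul_smul, inv_mul_cancel₀ hL0.ne', one_smul]
    nth_rewrite 1 [this]
    rw [← smul_sub, hS, hLeq]
    congr 1
    module
  have hAB : ‖A‖ ≤ B := norm_birkhoffAverage_le hB hn0 x
  have b1 : ‖(L₁ : ℝ) • A‖ ≤ M * B := by
    rw [norm_smul, Real.norm_natCast]; gcongr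
  have b2 : ‖(L₂ : ℝ) • A‖ ≤ M * B := by
    rw [norm_smul, Real.norm_natCast]; gcongr
  have b3 : ‖s₁‖ ≤ M * B := (h₁.norm_le hB).trans (by gcongr)
  have b4 : ‖s₂‖ ≤ M * B := (h₂.norm_le hB).trans (by gcongr)
  rw [dist_eq_norm, e, norm_smul, norm_inv, Real.norm_of_nonneg hL0.le, inv_mul_le_iff₀ hL0]
  calc ‖((L₁ : ℝ) • A + (L₂ : ℝ) • A) - (s₁ + s₂)‖
      ≤ (‖(L₁ : ℝ) • A‖ + ‖(L₂ : ℝ) • A‖) + (‖s₁‖ + ‖s₂‖) :=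
        (norm_sub_le _ _).trans (add_le_add (norm_add_le _ _) (norm_add_le _ _))
    _ ≤ 4 * M * B := by linarith
    _ ≤ n * ε := ((div_lt_iff₀ hε).1 hn).le
    _ ≤ L * ε := by gcongr

/-- The mean of `F` with respect to an invariant measure is a limit of averages over closed chains
at any given point `o`: it is the mean of the Birkhoff averages, which are close to the closed
convex set of such limits. -/
theorem integral_mem_closure_slopes_loops [CompleteSpace E] [MeasurableSpace X] [BorelSpace X]
    (hT : Continuous T) (htrans : IsTransitiveMap T) {μ : Measure X} [IsProbabilityMeasure μ]
    (hμ : MeasurePreserving T μ μ) {δ : ℝ} (hδ : 0 < δ) {F : X → E} (hF : Continuous F) (o : X) :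
    ∫ x, F x ∂μ ∈ closure (slopes (HasChain.loops T δ F o : Set (ℕ × E))) := by
  set D := slopes (HasChain.loops T δ F o : Set (ℕ × E))
  rw [← closure_closure, Metric.closure_eq_iInter_cthickening]
  refine Set.mem_iInter₂.2 fun ε hε => ?_
  obtain ⟨n, hn, hnear⟩ := exists_slope_near_birkhoffAverage htrans hδ hF o hε
  rw [← hμ.integral_birkhoffAverage hT hF hn]
  refine ((convex_closure_slopes (HasChain.loops T δ F o)).cthickening ε).integral_mem
    Metric.isClosed_cthickening (Eventually.of_forall fun x => ?_)
    ((hT.birkhoffAverage hF n).integrable_of_compactSpace μ)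
  obtain ⟨v, hv, hd⟩ := hnear x
  exact Metric.mem_cthickening_of_dist_le _ v _ _ (subset_closure hv) hd

end Approximation

/-! ### Tracing a periodic pseudo-orbit -/

theorem Function.Periodic.sum_range_add {E : Type*} [AddCommGroup E] {z : ℕ → E} {L : ℕ}
    (hz : z.Periodic L) (j : ℕ) : ∑ n ∈ range L, z (j + n) = ∑ n ∈ range L, z n := by
  induction j with
  | zero => simp
  | succ j ih =>
    have h := (sum_range_succ' (fun n => z (j + n)) L).symm.trans (sum_range_succ _ L)
    simp only [add_zero, hz j] at h
    rw [← ih, ← add_right_cancel h]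
    exact sum_congr rfl fun n _ => by rw [add_assoc, add_comm 1]

/-- Under shadowing, some orbit has all its Birkhoff averages over windows of a suitable length `L`
close to the mean of `F`, and visits the region where `g > 0` at least once in every window. It
traces a periodic pseudo-orbit through `o`, whose averages over windows of length `L` are constant.
-/
theorem exists_orbit_birkhoffAverage_near {X E : Type*} [MetricSpace X] [CompactSpace X]
    [MeasurableSpace X] [BorelSpace X] [NormedAddCommGroup E] [NormedSpace ℝ E] [CompleteSpace E]
    {T : X → X} (hT : Continuous T) (htrans : IsTransitiveMap T) (hshad : HasShadowing T)
    {μ : Measure X} [IsProbabilityMeasure μ] (hμ : MeasurePreserving T μ μ) {F : X → E}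
    (hF : Continuous F) {g : X → ℝ} (hg : Continuous g) (hg0 : ∀ x, 0 ≤ g x) {o : X}
    (ho : 0 < g o) {ε : ℝ} (hε : 0 < ε) :
    ∃ y : X, ∃ L, 0 < L ∧ (∀ j, ‖birkhoffAverage ℝ T F L (T^[j] y) - ∫ x, F x ∂μ‖ ≤ ε) ∧
      ∃ a : ℝ, 0 < a ∧ ∀ j, a ≤ birkhoffAverage ℝ T g L (T^[j] y) := by
  obtain ⟨η₁, hη₁, hunif⟩ := Metric.uniformContinuous_iff.1
    (CompactSpace.uniformContinuous_of_continuous hF) (ε / 2) (half_pos hε)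
  obtain ⟨η₂, hη₂, hball⟩ :=
    Metric.continuousAt_iff.1 (hg.continuousAt (x := o)) (g o / 2) (half_pos ho)
  obtain ⟨δ, hδ, hsh⟩ := hshad (min η₁ η₂) (lt_min hη₁ hη₂)
  obtain ⟨_, ⟨⟨L, s⟩, hs, hL, rfl⟩, hdist⟩ := Metric.mem_closure_iff.1
    (integral_mem_closure_slopes_loops hT htrans hμ hδ hF o) (ε / 2) (half_pos hε)
  obtain ⟨z, hz, hper, z0, hsum⟩ := HasChain.exists_periodic hs hL
  obtain ⟨y, hy⟩ := hsh z hz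
  dsimp only at hL hdist hper hsum
  have hLr : (0 : ℝ) < L := by exact_mod_cast hL
  refine ⟨y, L, hL, fun j => ?_, (L : ℝ)⁻¹ * (g o / 2), by positivity, fun j => ?_⟩
  · have hsj : ∑ n ∈ range L, F (z (j + n)) = s := by
      rw [← hsum]
      exact (hper.comp F).sum_range_add j
    have h1 : ‖birkhoffAverage ℝ T F L (T^[j] y) - (L : ℝ)⁻¹ • s‖ ≤ ε / 2 := by
      rw [birkhoffAverage, ← smul_sub, norm_smul, norm_inv, Real.norm_natCast,
        inv_mul_le_iff₀ hLr, birkhoffSum, ← hsj, ← sum_sub_distrib]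
      calc ‖∑ n ∈ range L, (F (T^[n] (T^[j] y)) - F (z (j + n)))‖
          ≤ ∑ _n ∈ range L, ε / 2 := norm_sum_le_of_le _ fun n _ => by
            rw [← Function.iterate_add_apply, add_comm n j, ← dist_eq_norm]
            exact (hunif ((hy (j + n)).trans_le (min_le_left _ _))).le
        _ = L * (ε / 2) := by simp
    rw [dist_eq_norm'] at hdist
    calc _ ≤ _ := norm_sub_le_norm_sub_add_norm_sub _ ((L : ℝ)⁻¹ • s) _
      _ ≤ ε := by linarith
  -- every window of length `L` contains a multiple of `L`, where the pseudo-orbit is at `o`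
  · obtain ⟨i, hi, hmod⟩ : ∃ i < L, (j + i) % L = 0 := by
      refine ⟨(L - j % L) % L, Nat.mod_lt _ hL, ?_⟩
      rw [Nat.add_mod_mod, ← Nat.mod_add_mod, Nat.add_sub_cancel' (Nat.mod_lt j hL).le,
        Nat.mod_self]
    have hzi : z (j + i) = o := by rw [← hper.map_mod_nat, hmod, z0]
    have hgi : g o / 2 ≤ g (T^[i] (T^[j] y)) := by
      rw [← Function.iterate_add_apply, add_comm i j]
      have := hball (x := T^[j + i] y) (by
        rw [← hzi]
        exact (hy (j + i)).trans_le (min_le_right _ _))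
      rw [Real.dist_eq] at this
      linarith [(abs_lt.1 this).1]
    rw [birkhoffAverage, smul_eq_mul]
    gcongr
    exact hgi.trans (single_le_sum (f := fun n => g (T^[n] (T^[j] y)))
      (fun n _ => hg0 _) (mem_range.2 hi))

/-! ### Generic ergodicity and full support -/

section Residual

variable {X : Type*} [MetricSpace X] [CompactSpace X] [MeasurableSpace X] [BorelSpace X]
  {T : X → X}

/-- Any invariant measure is approximated, on finitely many continuous functions `f ∈ S`, by
invariant measures that charge `{g > 0}` and for which the Birkhoff averages of every `f ∈ S` have
small variance. -/
theorem exists_invariantMeasure_near (hT : Continuous T) (htrans : IsTransitiveMap T)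
    (hshad : HasShadowing T) (μ : InvariantMeasures T) (S : Finset C(X, ℝ)) {g : X → ℝ}
    (hg : Continuous g) (hg0 : ∀ x, 0 ≤ g x) {o : X} (ho : 0 < g o) {ε : ℝ} (hε : 0 < ε) :
    ∃ ν : InvariantMeasures T, 0 < ∫ x, g x ∂(ν.1 : Measure X) ∧ ∃ n, 0 < n ∧ ∀ f ∈ S,
      |∫ x, f x ∂(ν.1 : Measure X) - ∫ x, f x ∂(μ.1 : Measure X)| ≤ ε ∧
        birkhoffVariance T f n (ν.1 : Measure X) ≤ ε ^ 2 := by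
  let F : X → S → ℝ := fun x f => f.1 x
  have hF : Continuous F := continuous_pi fun f => f.1.continuous
  obtain ⟨y, L, hL, hnear, a, ha, hvisit⟩ :=
    exists_orbit_birkhoffAverage_near hT htrans hshad μ.2 hF hg hg0 ho hε
  obtain ⟨ν, hν⟩ := exists_invariantMeasure_of_orbit hT y
  have hgpos : a ≤ ∫ x, g x ∂(ν.1 : Measure X) := by
    rw [← ν.2.integral_birkhoffAverage hT hg hL]
    exact hν _ (hT.birkhoffAverage hg L) a hvisit
  refine ⟨ν, ha.trans_le hgpos, L, hL, fun f hf => ?_⟩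
  set c := ∫ x, f x ∂(μ.1 : Measure X)
  have hsq : ∀ j, (birkhoffAverage ℝ T f L (T^[j] y) - c) ^ 2 ≤ ε ^ 2 := fun j => by
    have h1 := (norm_le_pi_norm _ ⟨f, hf⟩).trans (hnear j)
    rw [Pi.sub_apply, eval_integral fun f : S => f.1.continuous.integrable_of_compactSpace _] at h1
    have h2 : birkhoffAverage ℝ T F L (T^[j] y) ⟨f, hf⟩ = birkhoffAverage ℝ T f L (T^[j] y) := by
      simp [birkhoffAverage, birkhoffSum, F]
    rw [h2, Real.norm_eq_abs] at h1
    exact sq_le_sq' (abs_le.1 h1).1 (abs_le.1 h1).2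
  have hcont : Continuous fun x => (birkhoffAverage ℝ T f L x - c) ^ 2 :=
    ((hT.birkhoffAverage f.continuous L).sub continuous_const).pow 2
  have hint : ∫ x, (birkhoffAverage ℝ T f L x - c) ^ 2 ∂(ν.1 : Measure X) ≤ ε ^ 2 := by
    have := hν (fun x => -(birkhoffAverage ℝ T f L x - c) ^ 2) hcont.neg (-ε ^ 2)
      fun j => neg_le_neg (hsq j)
    rw [integral_neg] at this
    linarith
  have hvar0 : 0 ≤ birkhoffVariance T f L (ν.1 : Measure X) := by
    have := integral_sub_sq_eq_birkhoffVariance ν.2 hT f.continuous hL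
      (∫ x, f x ∂(ν.1 : Measure X))
    rw [sub_self, zero_pow two_ne_zero, add_zero] at this
    rw [← this]
    exact integral_nonneg fun x => sq_nonneg _
  rw [integral_sub_sq_eq_birkhoffVariance ν.2 hT f.continuous hL] at hint
  exact ⟨abs_le_of_sq_le_sq (by linarith) hε.le,
    by linarith [sq_nonneg (∫ x, f x ∂(ν.1 : Measure X) - c)]⟩

theorem dense_setOf_integral_pos (hT : Continuous T) (htrans : IsTransitiveMap T)
    (hshad : HasShadowing T) {g : X → ℝ} (hg : Continuous g) (hg0 : ∀ x, 0 ≤ g x) {o : X}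
    (ho : 0 < g o) : Dense {ν : InvariantMeasures T | 0 < ∫ x, g x ∂(ν.1 : Measure X)} :=
  dense_of_forall_finset_integral fun μ S _ hε =>
    let ⟨ν, hpos, _, _, hν⟩ := exists_invariantMeasure_near hT htrans hshad μ S hg hg0 ho hε
    ⟨ν, hpos, fun f hf => (hν f hf).1⟩

theorem dense_setOf_birkhoffVariance_lt (hT : Continuous T) (htrans : IsTransitiveMap T)
    (hshad : HasShadowing T) (f : C(X, ℝ)) {ε : ℝ} (hε : 0 < ε) :
    Dense {ν : InvariantMeasures T |
      ∃ n, 0 < n ∧ birkhoffVariance T f n (ν.1 : Measure X) < ε} := by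
  classical
  refine dense_of_forall_finset_integral fun μ S η hη => ?_
  obtain ⟨o⟩ : Nonempty X := μ.1.nonempty
  obtain ⟨ε', hε', hlt⟩ : ∃ ε' : ℝ, 0 < ε' ∧ ε' ^ 2 < ε :=
    ⟨√(ε / 2), by positivity, by rw [Real.sq_sqrt (by positivity)]; linarith⟩
  obtain ⟨ν, -, n, hn, hν⟩ := exists_invariantMeasure_near hT htrans hshad μ (insert f S)
    (g := fun _ => 1) continuous_const (fun _ => zero_le_one) (o := o) one_pos (lt_min hη hε')
  refine ⟨ν, ⟨n, hn, ?_⟩, fun h hh => (hν h (mem_insert_of_mem hh)).1.trans (min_le_left _ _)⟩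
  calc birkhoffVariance T f n (ν.1 : Measure X) ≤ min η ε' ^ 2 := (hν f (mem_insert_self _ _)).2
    _ ≤ ε' ^ 2 := pow_le_pow_left₀ (lt_min hη hε').le (min_le_right _ _) 2
    _ < ε := hlt

/-- Ergodicity is implied by countably many of the open dense conditions on the variances: those for
`f` in a dense sequence of continuous functions and the bounds `1 / (k + 1)`. -/
theorem residual_ergodic (hT : Continuous T) (htrans : IsTransitiveMap T)
    (hshad : HasShadowing T) :
    {ν : InvariantMeasures T | Ergodic T (ν.1 : Measure X)} ∈ residual (InvariantMeasures T) := by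
  let u := TopologicalSpace.denseSeq C(X, ℝ)
  have hmem : (⋂ q : ℕ × ℕ, {ν : InvariantMeasures T | ∃ n, 0 < n ∧
      birkhoffVariance T (u q.1) n (ν.1 : Measure X) < 1 / ((q.2 : ℝ) + 1)}) ∈
        residual (InvariantMeasures T) := by
    refine countable_iInter_mem.2 fun q => residual_of_dense_open ?_
      (dense_setOf_birkhoffVariance_lt hT htrans hshad (u q.1) (by positivity))
    have : {ν : InvariantMeasures T | ∃ n, 0 < n ∧
        birkhoffVariance T (u q.1) n (ν.1 : Measure X) < 1 / ((q.2 : ℝ) + 1)} =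
        ⋃ n, ⋃ _ : 0 < n, {ν | birkhoffVariance T (u q.1) n (ν.1 : Measure X) <
          1 / ((q.2 : ℝ) + 1)} := by
      ext; simp
    rw [this]
    exact isOpen_iUnion fun n => isOpen_iUnion fun _ =>
      isOpen_lt (continuous_birkhoffVariance hT (u q.1).continuous n) continuous_const
  refine mem_of_superset hmem fun ν hν => ?_
  refine ergodic_of_birkhoffVariance (TopologicalSpace.denseRange_denseSeq C(X, ℝ)) ν.2 hT
    fun i ε hε => ?_
  obtain ⟨k, hk⟩ := exists_nat_one_div_lt hε
  obtain ⟨n, hn, hlt⟩ := Set.mem_iInter.1 hν (i, k)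
  exact ⟨n, hn, hlt.trans hk⟩

/-- Full support follows from countably many of the open dense conditions on integrals: those for
bump functions of radius `1 / (k + 1)` about the points of a dense sequence. -/
theorem residual_support_eq_univ (hT : Continuous T) (htrans : IsTransitiveMap T)
    (hshad : HasShadowing T) :
    {ν : InvariantMeasures T | (ν.1 : Measure X).support = Set.univ} ∈
      residual (InvariantMeasures T) := by
  rcases isEmpty_or_nonempty X with hX | hX
  · exact univ_mem' fun ν => Set.eq_univ_of_forall fun x => hX.elim x
  let u := TopologicalSpace.denseSeq X
  -- a bump function that is positive precisely on the ball of radius `1 / (k + 1)` about `u i`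
  let g : ℕ × ℕ → X → ℝ := fun q x => max 0 (1 / ((q.2 : ℝ) + 1) - dist x (u q.1))
  have hg : ∀ q, Continuous (g q) := fun q => by fun_prop
  have hmem : (⋂ q : ℕ × ℕ, {ν : InvariantMeasures T | 0 < ∫ x, g q x ∂(ν.1 : Measure X)}) ∈
      residual (InvariantMeasures T) := by
    refine countable_iInter_mem.2 fun q => residual_of_dense_open
      (isOpen_lt continuous_const (continuous_integral_invariantMeasures (hg q)))
      (dense_setOf_integral_pos hT htrans hshad (hg q) (fun x => le_max_left _ _) (o := u q.1) ?_)
    simp only [g, dist_self, sub_zero]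
    exact lt_max_of_lt_right (by positivity)
  refine mem_of_superset hmem fun ν hν => Set.eq_univ_of_forall fun x => ?_
  rw [Measure.mem_support_iff_forall]
  intro U hU
  obtain ⟨r, hr, hrU⟩ := Metric.mem_nhds_iff.1 hU
  obtain ⟨k, hk⟩ := exists_nat_one_div_lt (half_pos hr)
  obtain ⟨i, hi⟩ := (TopologicalSpace.denseRange_denseSeq X).exists_dist_lt x (half_pos hr)
  by_contra h0
  have hpos : 0 < ∫ x, g (i, k) x ∂(ν.1 : Measure X) := Set.mem_iInter.1 hν (i, k)
  refine hpos.ne' (integral_eq_zero_of_ae ?_)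
  refine mem_of_superset (compl_mem_ae_iff.2 (not_lt.1 h0 |>.antisymm zero_le)) fun z hz => ?_
  refine max_eq_left (sub_nonpos.2 (le_of_not_gt fun hlt => hz (hrU ?_)))
  rw [Metric.mem_ball]
  linarith [dist_triangle_right z x (u i)]

end Residual

theorem mainTheorem6 {X : Type*} [MetricSpace X] [CompactSpace X] [MeasurableSpace X]
    [BorelSpace X] (T : X → X) (hT : Continuous T) (htrans : IsTransitiveMap T)
    (hshad : HasShadowing T) :
    {μ : InvariantMeasures T | Ergodic T (μ.1 : Measure X) ∧
      (μ.1 : Measure X).support = Set.univ} ∈ residual (InvariantMeasures T) :=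
  inter_mem (residual_ergodic hT htrans hshad) (residual_support_eq_univ hT htrans hshad)
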